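/- For every $n\in\mathbb N$ let $\mathcal H_n$ be a finite-dimensional complex Hilbert space, let $r\in\mathbb N$, and let $A_{1,n},\dots,A_{r,n}$ be positive semidefinite operators on $\mathcal H_n$. Write $\vec A_i=\{A_{i,n}\}_{n\in\mathbb N}$, and let $\log 0=-\infty$. For finitely many positive semidefinite operators $A_1,\dots,A_m$ let $$P_e^*(A_1,\dots,A_m)=\min\Big\{\sum_{i=1}^m \operatorname{Tr}A_i(I-E_i)\;:\;E_i\ge 0,\ \sum_{i=1}^m E_i\le I\Big\},$$ and let $$\overline p_e(\vec A_{1},\dots,\vec A_{m})=\limsup_{n\to\infty}\tfrac1n\log P_e^*(A_{1,n},\dots,A_{m,n}).$$ For two such sequences define the regularized Chernoff divergence $$C(\vec A_i,\vec A_j)=\liminf_{n\to\infty}\Big(-\tfrac1n\log\min_{0\le s\le 1}\operatorname{Tr}A_{i,n}^{s}A_{j,n}^{1-s}\Big),$$ where powers of a positive semidefinite operator are taken on its support only (so $A^0$ is the projection onto the support of $A$). All exponents take values in $[-\infty,+\infty]$. **Theorem.** Assume that $\limsup_{n\to\infty}\frac1n\log\operatorname{Tr}\sum_{i=1}^r A_{i,n}=0$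 (this holds, for instance, if $\sum_i\operatorname{Tr}A_{i,n}=1$ for every $n$). Pairs of indices below are unordered pairs of distinct indices in $\{1,\dots,r\}$. (1) For every pair $\{k,l\}$, $$\begin{aligned}\overline p_e(\vec A_1,\dots,\vec A_r)&\le\max\Big\{\overline p_e(\vec A_k,\vec A_l),\ \tfrac12\,\overline p_e(\vec A_i,\vec A_j)\;:\;\{i,j\}\ne\{k,l\}\Big\}\\&\le-\min\Big\{C(\vec A_k,\vec A_l),\ \tfrac12\,C(\vec A_i,\vec A_j)\;:\;\{i,j\}\ne\{k,l\}\Big\}.\end{aligned}$$ (2) In particular, suppose that there is a pair $\{k,l\}$ such that either $\overline p_e(\vec A_k,\vec A_l)\ge\frac12\,\overline p_e(\vec A_i,\vec A_j)$ for all pairs $\{i,j\}\ne\{k,l\}$, or $C(\vec A_k,\vec A_l)\le\frac12\,C(\vec A_i,\vec A_j)$ for all pairs $\{i,j\}\ne\{k,l\}$. Then $$\overline p_e(\vec A_1,\dots,\vec A_r)\le\max_{i\ne j}\overline p_e(\vec A_i,\vec A_j)\le-\min_{i\ne j}C(\vec A_i,\vec A_j).$$ -/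

import Mathlib

open Filter
open scoped ComplexOrder

noncomputable section

namespace StateDiscrimination

/-- An (incomplete) POVM with outcomes `κ`: positive semidefinite operators `E i` with
`∑ i, E i ≤ 1`. -/
def IsPOVM {κ ι : Type*} [Fintype κ] [Fintype ι] [DecidableEq ι]
    (E : κ → Matrix ι ι ℂ) : Prop :=
  (∀ i, (E i).PosSemidef) ∧ (1 - ∑ i, E i).PosSemidef

/-- The error `∑ i, Tr A i (1 - E i)` of the measurement `E` for the hypotheses `A`.
It is a nonnegative real number when the `A i` are positive semidefinite and `E` is a POVM. -/
def errorProb {κ ι : Type*} [Fintype κ] [Fintype ι] [DecidableEq ι]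
    (A E : κ → Matrix ι ι ℂ) : ℝ :=
  ∑ i, (Matrix.trace (A i * (1 - E i))).re

/-- The optimal error `P_e^*(A₁, …, A_r)`, the minimum of the error over all POVMs. -/
def optError {κ ι : Type*} [Fintype κ] [Fintype ι] [DecidableEq ι]
    (A : κ → Matrix ι ι ℂ) : ℝ :=
  sInf (errorProb A '' {E | IsPOVM E})

/-- Powers of a positive semidefinite matrix, taken on its support only: every eigenvalue `a > 0`
is replaced by `a ^ s`, and the kernel is left alone. In particular the power `0` is the projection
onto the support. -/
def suppPow {ι : Type*} [Fintype ι] [DecidableEq ι] (A : Matrix ι ι ℂ) (s : ℝ) : Matrix ι ι ℂ :=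
  cfc (fun x : ℝ => if x = 0 then 0 else x ^ s) A

/-- `Q_s(A‖B) = Tr A ^ s B ^ (1 - s)`. -/
def chernoffQ {ι : Type*} [Fintype ι] [DecidableEq ι] (A B : Matrix ι ι ℂ) (s : ℝ) : ℝ :=
  (Matrix.trace (suppPow A s * suppPow B (1 - s))).re

/-- `Q_min(A, B)`, the minimum of `Q_s(A‖B)` over `0 ≤ s ≤ 1`. -/
def chernoffQMin {ι : Type*} [Fintype ι] [DecidableEq ι] (A B : Matrix ι ι ℂ) : ℝ :=
  sInf (chernoffQ A B '' Set.Icc 0 1)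

/-- The logarithm of a nonnegative real number, with `log 0 = -∞`. -/
def elog (x : ℝ) : EReal := ENNReal.log (ENNReal.ofReal x)

/-- The Chernoff divergence `-log Q_min(A, B)`, which is `+∞` if `Q_min(A, B) = 0`. -/
def chernoffDiv {ι : Type*} [Fintype ι] [DecidableEq ι] (A B : Matrix ι ι ℂ) : EReal :=
  -elog (chernoffQMin A B)

/-- The upper error exponent `limsup (1 / n) log P_e^*(A_{1,n}, …, A_{r,n})`. -/
def upperExponent {κ : Type*} [Fintype κ] {ι : ℕ → Type*} [∀ n, Fintype (ι n)]
    [∀ n, DecidableEq (ι n)] (A : κ → (n : ℕ) → Matrix (ι n) (ι n) ℂ) : EReal :=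
  limsup (fun n : ℕ => ((1 / (n : ℝ) : ℝ) : EReal) * elog (optError fun i => A i n)) atTop

/-- The upper error exponent of the binary problem with hypotheses `A`, `B`. -/
def upperExponent₂ {ι : ℕ → Type*} [∀ n, Fintype (ι n)] [∀ n, DecidableEq (ι n)]
    (A B : (n : ℕ) → Matrix (ι n) (ι n) ℂ) : EReal :=
  upperExponent ![A, B]

/-- The regularized Chernoff divergence `liminf (1 / n) C(A_n, B_n)`. -/
def regChernoffDiv {ι : ℕ → Type*} [∀ n, Fintype (ι n)] [∀ n, DecidableEq (ι n)]
    (A B : (n : ℕ) → Matrix (ι n) (ι n) ℂ) : EReal :=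
  liminf (fun n : ℕ => ((1 / (n : ℝ) : ℝ) : EReal) * chernoffDiv (A n) (B n)) atTop

end StateDiscrimination

end

open StateDiscrimination

/-!
The theorem follows from a one-shot bound, valid in every dimension: the optimal error of `r`
hypotheses is at most `24 r` times the sum of the optimal errors of the pairs
(`optError_le_sum_pairs`). Hence the error exponent of the `r` hypotheses is at most the largest
exponent of a pair (`upperExponent_le_iSup_pairs`). The assumption on the traces makes the exponents
of the pairs nonpositive, so that each of them is at most its half, and the quantum Chernoff bound
`optError_le_chernoffQ` compares them with the Chernoff divergences.

For the one-shot bound, cut the eigenvalues of all `A i` at common dyadic thresholds `θ l`, and let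
`Q i l` be the spectral projection of `A i` for the eigenvalues `≥ θ l`. The measurement `flagTest`
comes from a Gram-Schmidt process in blocks: the eigenspaces are added one dyadic block after the
other, from the large to the small eigenvalues and at each level in the order of the hypotheses, and
the increment of the span caused by a block of `A i` is assigned to `i`. A block is measured wrongly
only through its overlap with the span of the earlier blocks. This span is generated by the ranges
of only `r` projections, one for each hypothesis, which matters because of the inequality

  `Tr P Π ≤ 2 ∑ j, Tr P (Q j) + ∑ j ≠ k, Tr (Q j) (Q k)`

for a projection `P` and the projection `Π` onto the span of the ranges of projections `Q j`
(`reTrace_mul_suppProj_sum_le`). So the block at level `l` contributes at most three times the sum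
of the overlaps `Tr (Q j (l + 1)) (Q k (l + 1))`, `j ≠ k`. Weighted with `θ l` and summed over `l`,
the overlaps of a pair are at most eight times the error of any binary test of that pair
(`sum_dyadic_overlap_le`): a positive matrix dominates a quarter of the weighted sum of
its dyadic layers, and two projections cannot be discriminated with an error below half of their
overlap.
Cutting dyadically is what keeps the number of eigenvalues out of the constant: within a block the
projections are treated at once, and between blocks the weights decay geometrically.

Matrices are compared in the Loewner order throughout.
-/

open scoped MatrixOrder

namespace StateDiscrimination

/-! ### The real part of the trace -/

section Trace

variable {ι : Type*} [Fintype ι]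

/-- The real part of the trace, as a real-linear functional. -/
noncomputable def reTrace : Matrix ι ι ℂ →ₗ[ℝ] ℝ :=
  Complex.reLm.comp (Matrix.traceLinearMap ι ℝ ℂ)

lemma reTrace_apply (A : Matrix ι ι ℂ) : reTrace A = (Matrix.trace A).re := rfl

lemma reTrace_mul_comm (A B : Matrix ι ι ℂ) : reTrace (A * B) = reTrace (B * A) := by
  simp only [reTrace_apply, Matrix.trace_mul_comm A B]

lemma reTrace_nonneg {A : Matrix ι ι ℂ} (hA : 0 ≤ A) : 0 ≤ reTrace A :=
  (Complex.nonneg_iff.1 (Matrix.nonneg_iff_posSemidef.1 hA).trace_nonneg).1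

lemma reTrace_mono {A B : Matrix ι ι ℂ} (h : A ≤ B) : reTrace A ≤ reTrace B := by
  have := reTrace_nonneg (sub_nonneg.2 h)
  rw [map_sub] at this
  linarith

variable [DecidableEq ι]

lemma reTrace_mul_nonneg {A B : Matrix ι ι ℂ} (hA : 0 ≤ A) (hB : 0 ≤ B) :
    0 ≤ reTrace (A * B) := by
  obtain ⟨C, rfl⟩ := CStarAlgebra.nonneg_iff_eq_star_mul_self.mp hA
  rw [mul_assoc, reTrace_mul_comm]
  exact reTrace_nonneg (star_right_conjugate_nonneg hB C)

lemma reTrace_mul_mono_left {A B C : Matrix ι ι ℂ} (hC : 0 ≤ C) (h : A ≤ B) :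
    reTrace (C * A) ≤ reTrace (C * B) := by
  have := reTrace_mul_nonneg hC (sub_nonneg.2 h)
  rw [mul_sub, map_sub] at this
  linarith

lemma reTrace_mul_mono_right {A B C : Matrix ι ι ℂ} (hC : 0 ≤ C) (h : A ≤ B) :
    reTrace (A * C) ≤ reTrace (B * C) := by
  rw [reTrace_mul_comm A, reTrace_mul_comm B]
  exact reTrace_mul_mono_left hC h

end Trace

/-! ### Support projections -/

section Support

variable {ι : Type*} [Fintype ι] [DecidableEq ι]

lemma continuousOn_spectrum (f : ℝ → ℝ) (A : Matrix ι ι ℂ) :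
    ContinuousOn f (spectrum ℝ A) :=
  A.finite_real_spectrum.continuousOn f

/-- The projection onto the support of a Hermitian matrix. -/
noncomputable def suppProj (A : Matrix ι ι ℂ) : Matrix ι ι ℂ :=
  cfc (fun x : ℝ => if x = 0 then 0 else 1) A

lemma isStarProjection_cfc_indicator (p : ℝ → Prop) [DecidablePred p] (A : Matrix ι ι ℂ) :
    IsStarProjection (cfc (fun x : ℝ => if p x then (1 : ℝ) else 0) A) := by
  refine ⟨?_, cfc_predicate _ _⟩
  rw [IsIdempotentElem, ← cfc_mul _ _ A (continuousOn_spectrum _ A) (continuousOn_spectrum _ A)]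
  congr 1; ext x; split_ifs <;> simp

lemma isStarProjection_suppProj (A : Matrix ι ι ℂ) : IsStarProjection (suppProj A) := by
  have := isStarProjection_cfc_indicator (fun x : ℝ => x ≠ 0) A
  simpa only [suppProj, ite_not] using this

lemma suppProj_mul_self {A : Matrix ι ι ℂ} (hA : IsSelfAdjoint A) : suppProj A * A = A := by
  conv_lhs => rw [suppProj]; arg 2; rw [← cfc_id' ℝ A]
  rw [← cfc_mul _ _ A (continuousOn_spectrum _ A) (continuousOn_spectrum _ A)]
  conv_rhs => rw [← cfc_id' ℝ A]
  congr 1; ext x; split_ifs <;> simp_all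

lemma mul_suppProj_self {A : Matrix ι ι ℂ} (hA : IsSelfAdjoint A) : A * suppProj A = A := by
  have := congrArg star (suppProj_mul_self hA)
  rwa [star_mul, hA.star_eq, (isStarProjection_suppProj A).isSelfAdjoint.star_eq] at this

lemma exists_mul_eq_suppProj {A : Matrix ι ι ℂ} (hA : IsSelfAdjoint A) :
    ∃ B, B * A = suppProj A := by
  refine ⟨cfc (fun x : ℝ => x⁻¹) A, ?_⟩
  conv_lhs => arg 2; rw [← cfc_id' ℝ A]
  rw [suppProj, ← cfc_mul _ _ A (continuousOn_spectrum _ A) (continuousOn_spectrum _ A)]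
  congr 1; ext x; split_ifs <;> simp_all

lemma isStarProjection_le_one {P : Matrix ι ι ℂ} (hP : IsStarProjection P) : P ≤ 1 := by
  rw [← sub_nonneg]
  exact hP.one_sub.nonneg

/-- The support projection is operator monotone on positive matrices. -/
lemma suppProj_mono {A B : Matrix ι ι ℂ} (hA : 0 ≤ A) (h : A ≤ B) : suppProj A ≤ suppProj B := by
  have hAs : IsSelfAdjoint A := hA.isSelfAdjoint
  have hBs : IsSelfAdjoint B := (hA.trans h).isSelfAdjoint
  set R := 1 - suppProj B with hR
  have hRs : star R = R := (isStarProjection_suppProj B).one_sub.isSelfAdjoint.star_eq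
  -- a vector in the kernel of `B` is in the kernel of `A`
  have h0 : A * R = 0 := by
    obtain ⟨C, rfl⟩ := CStarAlgebra.nonneg_iff_eq_star_mul_self.mp hA
    have h1 : star R * (star C * C) * R ≤ star R * B * R := star_left_conjugate_le_conjugate h R
    have h2 : B * R = 0 := by rw [hR, mul_sub, mul_one, mul_suppProj_self hBs, sub_self]
    rw [mul_assoc _ B, h2, mul_zero] at h1
    have h3 : star (C * R) * (C * R) = 0 := by
      refine le_antisymm ?_ (star_mul_self_nonneg _)
      simpa only [star_mul, mul_assoc] using h1
    have h4 : C * R = 0 := Matrix.conjTranspose_mul_self_eq_zero.1 h3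
    rw [mul_assoc, h4, mul_zero]
  obtain ⟨D, hD⟩ := exists_mul_eq_suppProj hAs
  have h1 : suppProj A * R = 0 := by rw [← hD, mul_assoc, h0, mul_zero]
  have h2 : suppProj A * suppProj B = suppProj A := by
    rw [hR, mul_sub, mul_one, sub_eq_zero] at h1
    exact h1.symm
  have h3 : suppProj B * suppProj A * suppProj B = suppProj A := by
    have := congrArg star h2
    rw [star_mul, (isStarProjection_suppProj A).isSelfAdjoint.star_eq,
      (isStarProjection_suppProj B).isSelfAdjoint.star_eq] at this
    rw [this, h2]
  rw [← h3]
  have := star_left_conjugate_le_conjugate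
    (isStarProjection_le_one (isStarProjection_suppProj A)) (suppProj B)
  rwa [(isStarProjection_suppProj B).isSelfAdjoint.star_eq, mul_one,
    (isStarProjection_suppProj B).isIdempotentElem.eq] at this

lemma suppProj_of_isStarProjection {P : Matrix ι ι ℂ} (hP : IsStarProjection P) :
    suppProj P = P := by
  obtain ⟨B, hB⟩ := exists_mul_eq_suppProj hP.isSelfAdjoint
  calc suppProj P = suppProj P * P := by rw [← hB, mul_assoc, hP.isIdempotentElem.eq]
    _ = P := suppProj_mul_self hP.isSelfAdjoint

/-- If `P ≤ S` for a projection `P` and `T = S ^ (-1/2)` on the support of `S`, then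
`Tr T P T ≤ Tr P`. The point is that `Z = P T² P` satisfies `Z² ≤ Z`, so that
`0 ≤ Tr (P - Z)² ≤ Tr P - Tr Z`. -/
lemma reTrace_conj_le {P T : Matrix ι ι ℂ} (hP : IsStarProjection P) (hT : star T = T)
    (h : T * P * T ≤ 1) : reTrace (T * P * T) ≤ reTrace P := by
  have hPP : P * P = P := hP.isIdempotentElem.eq
  have hPs : star P = P := hP.isSelfAdjoint.star_eq
  set Z := P * T * T * P with hZ
  have hPZ : P * Z = Z := by simp only [hZ, ← mul_assoc, hPP]
  have hZP : Z * P = Z := by simp only [hZ, mul_assoc, hPP]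
  have hZs : star Z = Z := by simp only [hZ, star_mul, hPs, hT, mul_assoc]
  have hZZ : Z * Z ≤ Z := by
    have := star_left_conjugate_le_conjugate h (T * P)
    simp only [star_mul, hPs, hT, mul_one] at this
    calc Z * Z = P * T * (T * P * T) * (T * P) := by
          simp only [hZ]
          calc P * T * T * P * (P * T * T * P) = P * T * T * (P * P) * T * T * P := by
                simp only [mul_assoc]
            _ = _ := by rw [hPP]; simp only [mul_assoc]
      _ ≤ P * T * (T * P) := this
      _ = Z := by simp only [hZ, mul_assoc]
  have h1 : 0 ≤ reTrace ((P - Z) * (P - Z)) := by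
    have := reTrace_nonneg (star_mul_self_nonneg (P - Z))
    rwa [star_sub, hPs, hZs] at this
  have h2 : (P - Z) * (P - Z) = P - Z - Z + Z * Z := by
    rw [sub_mul, mul_sub, mul_sub, hPP, hPZ, hZP]; abel
  rw [h2, map_add, map_sub, map_sub] at h1
  have h3 := reTrace_mono hZZ
  have h4 : reTrace (T * P * T) = reTrace Z := by
    calc reTrace (T * P * T) = reTrace (T * (P * P) * T) := by rw [hPP]
      _ = reTrace ((T * P) * (P * T)) := by simp only [mul_assoc]
      _ = reTrace ((P * T) * (T * P)) := reTrace_mul_comm _ _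
      _ = reTrace Z := by simp only [hZ, mul_assoc]
  linarith

/-- The rank of a sum of projections is at most the sum of their ranks. -/
lemma reTrace_suppProj_sum_le {κ : Type*} [Fintype κ] {Q : κ → Matrix ι ι ℂ}
    (hQ : ∀ j, IsStarProjection (Q j)) :
    reTrace (suppProj (∑ j, Q j)) ≤ reTrace (∑ j, Q j) := by
  set S := ∑ j, Q j with hS
  have hS0 : 0 ≤ S := Finset.sum_nonneg fun j _ => (hQ j).nonneg
  set T := cfc (fun x : ℝ => (√x)⁻¹) S with hT
  have hTs : star T = T := (cfc_predicate (R := ℝ) (p := IsSelfAdjoint) _ S).star_eq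
  have hTST : T * S * T = suppProj S := by
    conv_lhs => arg 1; arg 2; rw [← cfc_id' ℝ S hS0.isSelfAdjoint]
    rw [hT, suppProj,
      ← cfc_mul _ _ S (continuousOn_spectrum _ S) (continuousOn_spectrum _ S),
      ← cfc_mul _ _ S (continuousOn_spectrum _ S) (continuousOn_spectrum _ S)]
    refine cfc_congr fun x hx => ?_
    have hx0 : 0 ≤ x := spectrum_nonneg_of_nonneg hS0 hx
    rcases hx0.eq_or_lt with rfl | hx0
    · simp
    · have := Real.sqrt_pos.2 hx0
      have h2 := Real.mul_self_sqrt hx0.le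
      simp only [hx0.ne', if_false]
      field_simp
      nlinarith
  calc reTrace (suppProj S) = ∑ j, reTrace (T * Q j * T) := by
        rw [← hTST, hS, Finset.mul_sum, Finset.sum_mul, map_sum]
    _ ≤ ∑ j, reTrace (Q j) := by
        refine Finset.sum_le_sum fun j _ => reTrace_conj_le (hQ j) hTs ?_
        have hle : Q j ≤ S := Finset.single_le_sum (f := Q) (fun i _ => (hQ i).nonneg)
          (Finset.mem_univ j)
        have := star_left_conjugate_le_conjugate hle T
        rw [hTs, hTST] at this
        exact this.trans (isStarProjection_le_one (isStarProjection_suppProj S))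
    _ = reTrace S := by rw [hS, map_sum]

/-- The overlap of a projection `P` with the span `Π` of the ranges of projections `Q j` is
controlled by the overlaps of `P` with the `Q j` and of the `Q j` with each other, whatever the
dimensions. With `S = ∑ Q j` this comes from `Π ≤ 2 S + (S - Π)²` and `Tr Π ≤ Tr S`. -/
lemma reTrace_mul_suppProj_sum_le {κ : Type*} [Fintype κ] {Q : κ → Matrix ι ι ℂ}
    (hQ : ∀ j, IsStarProjection (Q j)) {P : Matrix ι ι ℂ} (hP : IsStarProjection P) :
    reTrace (P * suppProj (∑ j, Q j)) ≤
      2 * reTrace (P * ∑ j, Q j) + reTrace ((∑ j, Q j) * (∑ j, Q j) - ∑ j, Q j) := by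
  have h0 := reTrace_suppProj_sum_le hQ
  set S := ∑ j, Q j with hS
  have hSs : IsSelfAdjoint S :=
    (Finset.sum_nonneg fun j _ => (hQ j).nonneg : 0 ≤ S).isSelfAdjoint
  set R := suppProj S
  have hRR : R * R = R := (isStarProjection_suppProj S).isIdempotentElem.eq
  have hRs : star R = R := (isStarProjection_suppProj S).isSelfAdjoint.star_eq
  have hSR : S * R = S := mul_suppProj_self hSs
  have hRS : R * S = S := suppProj_mul_self hSs
  have hsq : (S - R) * (S - R) = S * S - S - S + R := by
    rw [sub_mul, mul_sub, mul_sub, hSR, hRS, hRR]; abel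
  have hsq0 : 0 ≤ (S - R) * (S - R) := by
    have := star_mul_self_nonneg (S - R)
    rwa [star_sub, hSs.star_eq, hRs] at this
  have hSS0 : 0 ≤ S * S := by
    have := star_mul_self_nonneg S
    rwa [hSs.star_eq] at this
  have h1 : reTrace (P * R) ≤ 2 * reTrace (P * S) + reTrace (P * ((S - R) * (S - R))) := by
    have := reTrace_mul_nonneg hP.nonneg hSS0
    rw [hsq, mul_add, mul_sub, mul_sub, map_add, map_sub, map_sub]
    linarith
  have h2 := reTrace_mul_mono_right hsq0 (isStarProjection_le_one hP)
  rw [one_mul] at h2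
  rw [hsq, map_add, map_sub, map_sub] at h2
  rw [hsq] at h1
  rw [map_sub]
  linarith

end Support

/-! ### Dyadic layers of a positive matrix -/

section Layers

variable {ι : Type*} [Fintype ι] [DecidableEq ι]

/-- The spectral projection of `A` for the eigenvalues `≥ t`. -/
noncomputable def levelProj (t : ℝ) (A : Matrix ι ι ℂ) : Matrix ι ι ℂ :=
  cfc (fun x : ℝ => if t ≤ x then (1 : ℝ) else 0) A

lemma isStarProjection_levelProj (t : ℝ) (A : Matrix ι ι ℂ) : IsStarProjection (levelProj t A) :=
  isStarProjection_cfc_indicator _ A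

lemma levelProj_anti {s t : ℝ} (h : s ≤ t) (A : Matrix ι ι ℂ) :
    levelProj t A ≤ levelProj s A := by
  refine cfc_mono (fun x _ => ?_) (continuousOn_spectrum _ A) (continuousOn_spectrum _ A)
  by_cases ht : t ≤ x
  · simp [ht, h.trans ht]
  · rw [if_neg ht]
    split_ifs <;> norm_num

lemma levelProj_mul_of_le {s t : ℝ} (h : s ≤ t) (A : Matrix ι ι ℂ) :
    levelProj s A * levelProj t A = levelProj t A := by
  rw [levelProj, levelProj,
    ← cfc_mul _ _ A (continuousOn_spectrum _ A) (continuousOn_spectrum _ A)]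
  congr 1; ext x
  by_cases ht : t ≤ x
  · simp [ht, h.trans ht]
  · simp [ht]

lemma mul_levelProj_of_le {s t : ℝ} (h : s ≤ t) (A : Matrix ι ι ℂ) :
    levelProj t A * levelProj s A = levelProj t A := by
  have := congrArg star (levelProj_mul_of_le h A)
  rwa [star_mul, (isStarProjection_levelProj _ A).isSelfAdjoint.star_eq,
    (isStarProjection_levelProj _ A).isSelfAdjoint.star_eq] at this

lemma isStarProjection_levelProj_sub {s t : ℝ} (h : s ≤ t) (A : Matrix ι ι ℂ) :
    IsStarProjection (levelProj s A - levelProj t A) := by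
  refine ⟨?_, (isStarProjection_levelProj s A).isSelfAdjoint.sub
    (isStarProjection_levelProj t A).isSelfAdjoint⟩
  rw [IsIdempotentElem, sub_mul, mul_sub, mul_sub, levelProj_mul_of_le h, mul_levelProj_of_le h,
    (isStarProjection_levelProj s A).isIdempotentElem.eq,
    (isStarProjection_levelProj t A).isIdempotentElem.eq]
  abel

lemma cfc_sum_smul {L : ℕ} (w : ℕ → ℝ) (f : ℕ → ℝ → ℝ) (A : Matrix ι ι ℂ) :
    cfc (fun x => ∑ l ∈ Finset.range L, w l * f l x) A =
      ∑ l ∈ Finset.range L, w l • cfc (f l) A := by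
  have h := cfc_sum (fun l x => w l * f l x) A (Finset.range L)
    (fun l _ => continuousOn_spectrum _ A)
  have h2 : (∑ l ∈ Finset.range L, fun x => w l * f l x) =
      fun x => ∑ l ∈ Finset.range L, w l * f l x := by
    ext x; simp
  rw [h2] at h
  rw [h]
  refine Finset.sum_congr rfl fun l _ => ?_
  exact cfc_const_mul (w l) (f l) A (continuousOn_spectrum _ A)

/-- The dyadic thresholds `τ, τ / 2, τ / 4, …`. -/
noncomputable def dyadic (τ : ℝ) (l : ℕ) : ℝ := τ / 2 ^ l

lemma dyadic_pos {τ : ℝ} (hτ : 0 < τ) (l : ℕ) : 0 < dyadic τ l := by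
  unfold dyadic; positivity

lemma dyadic_eq_two_mul (τ : ℝ) (l : ℕ) : dyadic τ l = 2 * dyadic τ (l + 1) := by
  unfold dyadic; rw [pow_succ]; field_simp

lemma dyadic_anti {τ : ℝ} (hτ : 0 < τ) : Antitone (dyadic τ) := by
  refine antitone_nat_of_succ_le fun l => ?_
  have := dyadic_pos hτ (l + 1)
  rw [dyadic_eq_two_mul τ l]; linarith

/-- A positive matrix is at most the dyadic rounding up of its eigenvalues. -/
lemma le_sum_dyadic_smul {τ : ℝ} (hτ : 0 < τ) {L : ℕ} {A : Matrix ι ι ℂ} (hA : 0 ≤ A)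
    (hlt : ∀ x ∈ spectrum ℝ A, x < τ) (hle : ∀ x ∈ spectrum ℝ A, x ≠ 0 → dyadic τ L ≤ x) :
    A ≤ ∑ l ∈ Finset.range L,
      dyadic τ l • (levelProj (dyadic τ (l + 1)) A - levelProj (dyadic τ l) A) := by
  have hs : ∀ l, levelProj (dyadic τ (l + 1)) A - levelProj (dyadic τ l) A =
      cfc (fun x : ℝ => (if dyadic τ (l + 1) ≤ x then (1 : ℝ) else 0) -
        if dyadic τ l ≤ x then (1 : ℝ) else 0) A := fun l =>
    (cfc_sub _ _ A (continuousOn_spectrum _ A) (continuousOn_spectrum _ A)).symm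
  simp_rw [hs]
  rw [← cfc_sum_smul]
  conv_lhs => rw [← cfc_id' ℝ A hA.isSelfAdjoint]
  refine cfc_mono (fun x hx => ?_) (continuousOn_spectrum _ A) (continuousOn_spectrum _ A)
  have hx0 : 0 ≤ x := spectrum_nonneg_of_nonneg hA hx
  have h1 : ∀ l, x * ((if dyadic τ (l + 1) ≤ x then (1 : ℝ) else 0) -
      if dyadic τ l ≤ x then (1 : ℝ) else 0) ≤ dyadic τ l *
        ((if dyadic τ (l + 1) ≤ x then (1 : ℝ) else 0) -
          if dyadic τ l ≤ x then (1 : ℝ) else 0) := fun l => by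
    have := dyadic_anti hτ (Nat.le_succ l)
    rw [Nat.succ_eq_add_one] at this
    split_ifs <;> linarith
  refine le_trans ?_ (Finset.sum_le_sum fun l _ => h1 l)
  rw [← Finset.mul_sum, Finset.sum_range_sub (fun l => if dyadic τ l ≤ x then (1 : ℝ) else 0)]
  have h2 : ¬ dyadic τ 0 ≤ x := by simpa [dyadic] using hlt x hx
  rw [if_neg h2, sub_zero]
  rcases eq_or_ne x 0 with rfl | hne
  · simp
  · rw [if_pos (hle x hx hne), mul_one]

lemma sum_dyadic_indicator_le {τ : ℝ} (hτ : 0 < τ) {x : ℝ} (hx : 0 ≤ x) (L : ℕ) :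
    ∑ l ∈ Finset.range L, dyadic τ l * (if dyadic τ (l + 1) ≤ x then (1 : ℝ) else 0) ≤ 4 * x := by
  have key : ∑ l ∈ Finset.range L, dyadic τ l * (if dyadic τ (l + 1) ≤ x then (1 : ℝ) else 0) ≤
      if dyadic τ L ≤ x then 4 * x - 2 * dyadic τ L else 0 := by
    induction L with
    | zero =>
      simp only [Finset.range_zero, Finset.sum_empty]
      have := dyadic_pos hτ 0
      split_ifs <;> linarith
    | succ L ih =>
      rw [Finset.sum_range_succ]
      have h1 := dyadic_pos hτ (L + 1)
      have h2 := dyadic_eq_two_mul τ L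
      split_ifs at ih ⊢ <;> linarith
  have := dyadic_pos hτ L
  split_ifs at key <;> linarith

/-- A positive matrix dominates a quarter of the sum of its dyadic layers. -/
lemma sum_dyadic_smul_le {τ : ℝ} (hτ : 0 < τ) (L : ℕ) {A : Matrix ι ι ℂ} (hA : 0 ≤ A) :
    ∑ l ∈ Finset.range L, dyadic τ l • levelProj (dyadic τ (l + 1)) A ≤ (4 : ℝ) • A := by
  simp only [levelProj]
  rw [← cfc_sum_smul]
  conv_rhs => rw [← cfc_id' ℝ A hA.isSelfAdjoint]
  rw [← cfc_const_mul _ _ A (continuousOn_spectrum _ A)]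
  exact cfc_mono (fun x hx => sum_dyadic_indicator_le hτ (spectrum_nonneg_of_nonneg hA hx) L)
    (continuousOn_spectrum _ A) (continuousOn_spectrum _ A)

end Layers

/-! ### Lower bounds on binary errors -/

section Binary

variable {ι : Type*} [Fintype ι] [DecidableEq ι]

/-- No test discriminates two projections with an error below half of their overlap. -/
lemma half_reTrace_mul_le {P Q E : Matrix ι ι ℂ} (hP : IsStarProjection P)
    (hQ : IsStarProjection Q) (hE : 0 ≤ E) (hE1 : E ≤ 1) :
    reTrace (P * Q) / 2 ≤ reTrace (P * (1 - E)) + reTrace (Q * E) := by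
  have hPP : P * P = P := hP.isIdempotentElem.eq
  have hPs : star P = P := hP.isSelfAdjoint.star_eq
  have hQQ : Q * Q = Q := hQ.isIdempotentElem.eq
  have hQs : star Q = Q := hQ.isSelfAdjoint.star_eq
  have key : ∀ {F : Matrix ι ι ℂ}, 0 ≤ F → F ≤ 1 → ∀ {P Q : Matrix ι ι ℂ},
      IsStarProjection P → IsStarProjection Q →
      reTrace (star (P * F * Q) * (P * F * Q)) ≤ reTrace (Q * F) := by
    intro F hF hF1 P Q hP hQ
    have hPP : P * P = P := hP.isIdempotentElem.eq
    have hPs : star P = P := hP.isSelfAdjoint.star_eq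
    have hQQ : Q * Q = Q := hQ.isIdempotentElem.eq
    have hQs : star Q = Q := hQ.isSelfAdjoint.star_eq
    have hFs : star F = F := hF.isSelfAdjoint.star_eq
    have h1 : reTrace (star (P * F * Q) * (P * F * Q)) = reTrace (Q * (F * P * F)) := by
      calc _ = reTrace (Q * F * (P * P) * F * Q) := by
            simp only [star_mul, hPs, hQs, hFs, mul_assoc]
        _ = reTrace (Q * (Q * F * (P * P) * F)) := reTrace_mul_comm _ _
        _ = reTrace ((Q * Q) * (F * P * F)) := by rw [hPP]; simp only [mul_assoc]
        _ = _ := by rw [hQQ]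
    have h2 : F * P * F ≤ F := by
      have h3 : F * P * F ≤ F * F := by
        have := star_left_conjugate_le_conjugate (isStarProjection_le_one hP) F
        rwa [hFs, mul_one] at this
      refine h3.trans ?_
      obtain ⟨C, hCs, hC⟩ : ∃ C : Matrix ι ι ℂ, star C = C ∧ C * C = F :=
        ⟨CFC.sqrt F, (CFC.sqrt_nonneg F).isSelfAdjoint.star_eq, CFC.sqrt_mul_sqrt_self F⟩
      have := star_left_conjugate_le_conjugate hF1 C
      rw [hCs, mul_one, hC] at this
      calc F * F = C * F * C := by rw [← hC]; simp only [mul_assoc]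
        _ ≤ F := this
    rw [h1]
    exact reTrace_mul_mono_left hQ.nonneg h2
  have h1 := key hE hE1 hP hQ
  have h2 := key (sub_nonneg.2 hE1) (sub_le_self 1 hE) hQ hP
  -- `P Q` splits into the two pieces, one of which is at least half as long
  set X := P * E * Q with hX
  set Y := P * (1 - E) * Q with hY
  have hXY : X + Y = P * Q := by rw [hX, hY]; noncomm_ring
  have h3 : reTrace (star (Q * (1 - E) * P) * (Q * (1 - E) * P)) = reTrace (star Y * Y) := by
    have : Q * (1 - E) * P = star Y := by
      simp only [hY, star_mul, star_sub, star_one, hPs, hQs, hE.isSelfAdjoint.star_eq, mul_assoc]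
    rw [this, star_star, reTrace_mul_comm]
  rw [h3] at h2
  have h4 : reTrace (P * Q) = reTrace (star (X + Y) * (X + Y)) := by
    calc reTrace (P * Q) = reTrace (P * (Q * Q)) := by rw [hQQ]
      _ = reTrace (P * Q * Q) := by rw [mul_assoc]
      _ = reTrace (Q * (P * Q)) := reTrace_mul_comm _ _
      _ = reTrace (Q * (P * P) * Q) := by rw [hPP, mul_assoc]
      _ = _ := by rw [hXY, star_mul, hPs, hQs]; simp only [mul_assoc]
  have h5 := reTrace_nonneg (star_mul_self_nonneg (X - Y))
  have h6 : star (X + Y) * (X + Y) + star (X - Y) * (X - Y) =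
      (2 : ℝ) • (star X * X) + (2 : ℝ) • (star Y * Y) := by
    rw [star_add, star_sub, two_smul, two_smul]; noncomm_ring
  have h7 := congrArg reTrace h6
  rw [map_add, map_add, map_smul, map_smul, smul_eq_mul, smul_eq_mul, ← h4] at h7
  linarith

/-- The dyadic overlaps of two positive matrices bound every binary error from below. -/
lemma sum_dyadic_overlap_le {τ : ℝ} (hτ : 0 < τ) (L : ℕ) {A B E : Matrix ι ι ℂ} (hA : 0 ≤ A)
    (hB : 0 ≤ B) (hE : 0 ≤ E) (hE1 : E ≤ 1) :
    ∑ l ∈ Finset.range L, dyadic τ l *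
        reTrace (levelProj (dyadic τ (l + 1)) A * levelProj (dyadic τ (l + 1)) B) ≤
      8 * (reTrace (A * (1 - E)) + reTrace (B * E)) := by
  have h1 := reTrace_mul_mono_right (sub_nonneg.2 hE1) (sum_dyadic_smul_le hτ L hA)
  have h2 := reTrace_mul_mono_right hE (sum_dyadic_smul_le hτ L hB)
  simp only [Finset.sum_mul, map_sum, smul_mul_assoc, map_smul, smul_eq_mul] at h1 h2
  have h3 : ∑ l ∈ Finset.range L, dyadic τ l *
        reTrace (levelProj (dyadic τ (l + 1)) A * levelProj (dyadic τ (l + 1)) B) ≤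
      ∑ l ∈ Finset.range L, 2 * (dyadic τ l * reTrace (levelProj (dyadic τ (l + 1)) A * (1 - E)) +
        dyadic τ l * reTrace (levelProj (dyadic τ (l + 1)) B * E)) := by
    refine Finset.sum_le_sum fun l _ => ?_
    have := half_reTrace_mul_le (isStarProjection_levelProj (dyadic τ (l + 1)) A)
      (isStarProjection_levelProj (dyadic τ (l + 1)) B) hE hE1
    have h4 := dyadic_pos hτ l
    nlinarith
  rw [← Finset.mul_sum, Finset.sum_add_distrib] at h3
  linarith

end Binary

/-! ### Errors of measurements -/

section Measurements

variable {ι : Type*} [Fintype ι] [DecidableEq ι]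

lemma isPOVM_iff {κ : Type*} [Fintype κ] {E : κ → Matrix ι ι ℂ} :
    IsPOVM E ↔ (∀ i, 0 ≤ E i) ∧ ∑ i, E i ≤ 1 := by
  simp only [IsPOVM, Matrix.le_iff, sub_zero]

lemma errorProb_eq {κ : Type*} [Fintype κ] (A E : κ → Matrix ι ι ℂ) :
    errorProb A E = ∑ i, reTrace (A i * (1 - E i)) := rfl

lemma IsPOVM.le_one {κ : Type*} [Fintype κ] {E : κ → Matrix ι ι ℂ} (hE : IsPOVM E) (i : κ) :
    E i ≤ 1 := by
  rw [isPOVM_iff] at hE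
  exact (Finset.single_le_sum (f := E) (fun j _ => hE.1 j) (Finset.mem_univ i)).trans hE.2

lemma errorProb_nonneg {κ : Type*} [Fintype κ] {A E : κ → Matrix ι ι ℂ} (hA : ∀ i, 0 ≤ A i)
    (hE : IsPOVM E) : 0 ≤ errorProb A E :=
  Finset.sum_nonneg fun i _ => reTrace_mul_nonneg (hA i) (sub_nonneg.2 (hE.le_one i))

lemma isPOVM_zero {κ : Type*} [Fintype κ] : IsPOVM (0 : κ → Matrix ι ι ℂ) := by
  simp [isPOVM_iff]

lemma bddBelow_errorProb {κ : Type*} [Fintype κ] {A : κ → Matrix ι ι ℂ} (hA : ∀ i, 0 ≤ A i) :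
    BddBelow (errorProb A '' {E | IsPOVM E}) :=
  ⟨0, by rintro _ ⟨E, hE, rfl⟩; exact errorProb_nonneg hA hE⟩

lemma optError_le {κ : Type*} [Fintype κ] {A E : κ → Matrix ι ι ℂ} (hA : ∀ i, 0 ≤ A i)
    (hE : IsPOVM E) : optError A ≤ errorProb A E :=
  csInf_le (bddBelow_errorProb hA) ⟨E, hE, rfl⟩

lemma optError_nonneg {κ : Type*} [Fintype κ] {A : κ → Matrix ι ι ℂ} (hA : ∀ i, 0 ≤ A i) :
    0 ≤ optError A :=
  Real.sInf_nonneg (by rintro _ ⟨E, hE, rfl⟩; exact errorProb_nonneg hA hE)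

lemma le_optError {κ : Type*} [Fintype κ] {A : κ → Matrix ι ι ℂ} {c : ℝ}
    (h : ∀ E, IsPOVM E → c ≤ errorProb A E) : c ≤ optError A :=
  le_csInf ⟨_, 0, isPOVM_zero, rfl⟩ (by rintro _ ⟨E, hE, rfl⟩; exact h E hE)

end Measurements

/-! ### The block Gram-Schmidt measurement -/

section Flag

variable {ι : Type*} [Fintype ι] [DecidableEq ι] {r : ℕ}

/-- The projection onto the span of the eigenvectors of `A j` collected when, at the dyadic level `l`, the
hypotheses `0, …, m - 1` have already been processed. -/
noncomputable def stageProj (A : Fin r → Matrix ι ι ℂ) (τ : ℝ) (l m : ℕ) (j : Fin r) :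
    Matrix ι ι ℂ :=
  levelProj (dyadic τ (if (j : ℕ) < m then l + 1 else l)) (A j)

/-- The projection onto the span of all eigenvectors collected up to the stage `(l, m)`. -/
noncomputable def flagProj (A : Fin r → Matrix ι ι ℂ) (τ : ℝ) (l m : ℕ) : Matrix ι ι ℂ :=
  suppProj (∑ j, stageProj A τ l m j)

lemma isStarProjection_stageProj (A : Fin r → Matrix ι ι ℂ) (τ : ℝ) (l m : ℕ) (j : Fin r) :
    IsStarProjection (stageProj A τ l m j) :=
  isStarProjection_levelProj _ _

lemma stageProj_mono (A : Fin r → Matrix ι ι ℂ) {τ : ℝ} (hτ : 0 < τ) (l m : ℕ) (j : Fin r) :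
    stageProj A τ l m j ≤ stageProj A τ l (m + 1) j := by
  refine levelProj_anti (dyadic_anti hτ ?_) _
  split_ifs <;> omega

lemma stageProj_le (A : Fin r → Matrix ι ι ℂ) {τ : ℝ} (hτ : 0 < τ) (l m : ℕ) (j : Fin r) :
    stageProj A τ l m j ≤ levelProj (dyadic τ (l + 1)) (A j) := by
  refine levelProj_anti (dyadic_anti hτ ?_) _
  split_ifs <;> omega

lemma flagProj_mono (A : Fin r → Matrix ι ι ℂ) {τ : ℝ} (hτ : 0 < τ) (l m : ℕ) :
    flagProj A τ l m ≤ flagProj A τ l (m + 1) :=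
  suppProj_mono (Finset.sum_nonneg fun j _ => (isStarProjection_stageProj A τ l m j).nonneg)
    (Finset.sum_le_sum fun j _ => stageProj_mono A hτ l m j)

lemma flagProj_card (A : Fin r → Matrix ι ι ℂ) (τ : ℝ) (l : ℕ) :
    flagProj A τ l r = flagProj A τ (l + 1) 0 := by
  simp [flagProj, stageProj]

/-- The measurement obtained by orthogonalizing the eigenvectors of all hypotheses, in blocks,
from the large to the small eigenvalues: the block `(l, i)` of the flag is assigned to the
hypothesis `i`. -/
noncomputable def flagTest (A : Fin r → Matrix ι ι ℂ) (τ : ℝ) (L : ℕ) (i : Fin r) :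
    Matrix ι ι ℂ :=
  ∑ l ∈ Finset.range L, (flagProj A τ l (i + 1) - flagProj A τ l i)

lemma isPOVM_flagTest (A : Fin r → Matrix ι ι ℂ) {τ : ℝ} (hτ : 0 < τ) (L : ℕ) :
    IsPOVM (flagTest A τ L) := by
  rw [isPOVM_iff]
  refine ⟨fun i => Finset.sum_nonneg fun l _ => sub_nonneg.2 (flagProj_mono A hτ l i), ?_⟩
  have h : ∑ i, flagTest A τ L i = flagProj A τ L 0 - flagProj A τ 0 0 := by
    simp only [flagTest]
    rw [Finset.sum_comm, ← Finset.sum_range_sub (fun l => flagProj A τ l 0)]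
    refine Finset.sum_congr rfl fun l _ => ?_
    rw [Fin.sum_univ_eq_sum_range (fun m => flagProj A τ l (m + 1) - flagProj A τ l m),
      Finset.sum_range_sub (fun m => flagProj A τ l m), flagProj_card]
  rw [h]
  exact (sub_le_self _ (isStarProjection_suppProj _).nonneg).trans
    (isStarProjection_le_one (isStarProjection_suppProj _))

lemma reTrace_mul_le_mul {A B C D : Matrix ι ι ℂ} (hA : 0 ≤ A) (hD : 0 ≤ D) (hAC : A ≤ C)
    (hBD : B ≤ D) : reTrace (A * B) ≤ reTrace (C * D) :=
  (reTrace_mul_mono_left hA hBD).trans (reTrace_mul_mono_right hD hAC)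

/-- On the eigenvectors of `A i` at the dyadic level `l` the measurement `flagTest` errs by at most
three times the total overlap of the eigenvectors of different hypotheses above this level. -/
lemma reTrace_layer_mul_le (A : Fin r → Matrix ι ι ℂ) {τ : ℝ} (hτ : 0 < τ) {L l : ℕ}
    (hl : l < L) (i : Fin r) :
    reTrace ((levelProj (dyadic τ (l + 1)) (A i) - levelProj (dyadic τ l) (A i)) *
        (1 - flagTest A τ L i)) ≤
      3 * ∑ j, ∑ k, if j ≠ k then reTrace (levelProj (dyadic τ (l + 1)) (A j) *
        levelProj (dyadic τ (l + 1)) (A k)) else 0 := by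
  have hdy := dyadic_anti hτ (Nat.le_succ l)
  set Q : Fin r → Matrix ι ι ℂ := fun j => levelProj (dyadic τ (l + 1)) (A j) with hQ
  have hQp : ∀ j, IsStarProjection (Q j) := fun j => isStarProjection_levelProj _ _
  set R : Fin r → Matrix ι ι ℂ := stageProj A τ l i with hR
  have hRp : ∀ j, IsStarProjection (R j) := isStarProjection_stageProj A τ l i
  have hRQ : ∀ j, R j ≤ Q j := stageProj_le A hτ l i
  have hRi : R i = levelProj (dyadic τ l) (A i) := by simp [hR, stageProj]
  set P := levelProj (dyadic τ (l + 1)) (A i) - levelProj (dyadic τ l) (A i) with hP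
  have hPp : IsStarProjection P := isStarProjection_levelProj_sub hdy _
  have hPQ : P ≤ Q i := sub_le_self _ (isStarProjection_levelProj _ _).nonneg
  have hPR : P * R i = 0 := by
    rw [hRi, hP, sub_mul, levelProj_mul_of_le hdy,
      (isStarProjection_levelProj _ _).isIdempotentElem.eq, sub_self]
  -- the block `(l, i)` contains `P` up to the overlap with the earlier blocks
  have h1 : reTrace (P * (1 - flagTest A τ L i)) ≤ reTrace (P * flagProj A τ l i) := by
    have ha : flagProj A τ l (i + 1) - flagProj A τ l i ≤ flagTest A τ L i :=
      Finset.single_le_sum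
        (f := fun l => flagProj A τ l ((i : ℕ) + 1) - flagProj A τ l (i : ℕ))
        (fun l _ => sub_nonneg.2 (flagProj_mono A hτ l i)) (Finset.mem_range.2 hl)
    have hb : P ≤ flagProj A τ l (i + 1) := by
      have hc : Q i ≤ ∑ j, stageProj A τ l (i + 1) j := by
        have hd : Q i = stageProj A τ l (i + 1) i := by simp [hQ, stageProj]
        rw [hd]
        exact Finset.single_le_sum (f := fun j => stageProj A τ l (i + 1) j)
          (fun j _ => (isStarProjection_stageProj A τ l _ j).nonneg) (Finset.mem_univ i)
      have := suppProj_mono (hQp i).nonneg hc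
      rw [suppProj_of_isStarProjection (hQp i)] at this
      exact hPQ.trans this
    have hd : reTrace (P * (1 - flagProj A τ l (i + 1))) ≤ 0 := by
      have h2 := reTrace_mul_mono_right
        (sub_nonneg.2 (isStarProjection_le_one (isStarProjection_suppProj
          (∑ j, stageProj A τ l (i + 1) j)))) hb
      refine h2.trans (le_of_eq ?_)
      rw [flagProj, mul_sub, mul_one, (isStarProjection_suppProj _).isIdempotentElem.eq, sub_self,
        map_zero]
    have he := reTrace_mul_mono_left hPp.nonneg (sub_le_sub_left ha 1)
    have hf : (1 : Matrix ι ι ℂ) - (flagProj A τ l (i + 1) - flagProj A τ l i) =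
        (1 - flagProj A τ l (i + 1)) + flagProj A τ l i := by abel
    rw [hf, mul_add, map_add] at he
    linarith
  have h2 : reTrace (P * flagProj A τ l i) ≤
      2 * reTrace (P * ∑ j, R j) + reTrace ((∑ j, R j) * (∑ j, R j) - ∑ j, R j) :=
    reTrace_mul_suppProj_sum_le hRp hPp
  have hov : ∀ j k, 0 ≤ reTrace (Q j * Q k) := fun j k =>
    reTrace_mul_nonneg (hQp j).nonneg (hQp k).nonneg
  have hterm : ∀ j k, 0 ≤ if j ≠ k then reTrace (Q j * Q k) else 0 := fun j k => by
    split_ifs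
    exacts [hov j k, le_rfl]
  have h3 : reTrace (P * ∑ j, R j) ≤ ∑ j, ∑ k, if j ≠ k then reTrace (Q j * Q k) else 0 := by
    calc reTrace (P * ∑ j, R j) = ∑ k, reTrace (P * R k) := by rw [Finset.mul_sum, map_sum]
      _ ≤ ∑ k, if i ≠ k then reTrace (Q i * Q k) else 0 := by
        refine Finset.sum_le_sum fun k _ => ?_
        split_ifs with h
        · exact reTrace_mul_le_mul hPp.nonneg (hQp k).nonneg hPQ (hRQ k)
        · rw [← not_not.1 h, hPR, map_zero]
      _ ≤ _ := Finset.single_le_sum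
        (f := fun j => ∑ k, if j ≠ k then reTrace (Q j * Q k) else 0)
        (fun j _ => Finset.sum_nonneg fun k _ => hterm j k) (Finset.mem_univ i)
  have h4 : reTrace ((∑ j, R j) * (∑ j, R j) - ∑ j, R j) ≤
      ∑ j, ∑ k, if j ≠ k then reTrace (Q j * Q k) else 0 := by
    rw [Finset.sum_mul_sum, ← Finset.sum_sub_distrib, map_sum]
    refine Finset.sum_le_sum fun j _ => ?_
    have : ∑ k, R j * R k - R j = ∑ k, if j ≠ k then R j * R k else 0 := by
      rw [← Finset.add_sum_erase _ _ (Finset.mem_univ j), (hRp j).isIdempotentElem.eq,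
        add_sub_cancel_left, ← Finset.add_sum_erase _ (fun k => if j ≠ k then R j * R k else 0)
          (Finset.mem_univ j), if_neg (not_not.2 rfl), zero_add]
      refine Finset.sum_congr rfl fun k hk => ?_
      rw [if_pos (Finset.ne_of_mem_erase hk).symm]
    rw [this, map_sum]
    refine Finset.sum_le_sum fun k _ => ?_
    split_ifs
    · exact reTrace_mul_le_mul (hRp j).nonneg (hQp k).nonneg (hRQ j) (hRQ k)
    · rw [map_zero]
  linarith

lemma exists_dyadic_bounds {s : Set ℝ} (hs : s.Finite) :
    ∃ τ : ℝ, 0 < τ ∧ ∃ L : ℕ, ∀ x ∈ s, 0 ≤ x → x < τ ∧ (x ≠ 0 → dyadic τ L ≤ x) := by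
  obtain ⟨M, hM⟩ := hs.bddAbove
  refine ⟨max M 0 + 1, by positivity, ?_⟩
  set τ := max M 0 + 1 with hτ
  have hlim : Tendsto (dyadic τ) atTop (nhds 0) := by
    have := (tendsto_pow_atTop_nhds_zero_of_lt_one (r := (1 / 2 : ℝ)) (by norm_num)
      (by norm_num)).const_mul τ
    rw [mul_zero] at this
    refine this.congr fun l => ?_
    rw [dyadic, one_div, inv_pow, div_eq_mul_inv]
  have hev : ∀ᶠ L in atTop, ∀ x ∈ s, 0 < x → dyadic τ L ≤ x := by
    rw [hs.eventually_all]
    intro x _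
    by_cases hx : 0 < x
    · filter_upwards [hlim.eventually (gt_mem_nhds hx)] with L hL _ using hL.le
    · exact Eventually.of_forall fun _ h => absurd h hx
  obtain ⟨L, hL⟩ := hev.exists
  refine ⟨L, fun x hx hx0 => ⟨?_, fun hne => hL x hx (lt_of_le_of_ne hx0 hne.symm)⟩⟩
  have := hM hx
  have := le_max_left M 0
  linarith

lemma IsPOVM.le_one_sub {E : Fin 2 → Matrix ι ι ℂ} (hE : IsPOVM E) : E 1 ≤ 1 - E 0 := by
  have := (isPOVM_iff.1 hE).2
  rw [Fin.sum_univ_two] at this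
  exact le_sub_iff_add_le'.2 this

lemma forall_fin_two_nonneg {α : Type*} [Zero α] [Preorder α] {A B : α} (hA : 0 ≤ A)
    (hB : 0 ≤ B) (i : Fin 2) : 0 ≤ (![A, B] : Fin 2 → α) i := by
  fin_cases i
  exacts [hA, hB]

lemma sum_dyadic_overlap_le_optError {τ : ℝ} (hτ : 0 < τ) (L : ℕ) {A B : Matrix ι ι ℂ}
    (hA : 0 ≤ A) (hB : 0 ≤ B) :
    ∑ l ∈ Finset.range L, dyadic τ l *
        reTrace (levelProj (dyadic τ (l + 1)) A * levelProj (dyadic τ (l + 1)) B) ≤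
      8 * optError ![A, B] := by
  rw [← div_le_iff₀' (by norm_num)]
  refine le_optError fun E hE => ?_
  rw [div_le_iff₀' (by norm_num)]
  refine (sum_dyadic_overlap_le hτ L hA hB ((isPOVM_iff.1 hE).1 0) (hE.le_one 0)).trans ?_
  rw [errorProb_eq, Fin.sum_univ_two]
  have h1 : E 0 ≤ 1 - E 1 := le_sub_comm.1 hE.le_one_sub
  have := reTrace_mul_mono_left hB h1
  simp only [Matrix.cons_val_zero, Matrix.cons_val_one]
  linarith

/-- The optimal error of `r` hypotheses is at most a constant, depending only on `r`, times the sum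
of the optimal errors of the pairs. -/
theorem optError_le_sum_pairs {A : Fin r → Matrix ι ι ℂ} (hA : ∀ i, 0 ≤ A i) :
    optError A ≤ 24 * r * ∑ j, ∑ k, if j ≠ k then optError ![A j, A k] else 0 := by
  obtain ⟨τ, hτ, L, hL⟩ := exists_dyadic_bounds
    (Set.finite_iUnion fun i => (A i).finite_real_spectrum)
  have hL' : ∀ i, ∀ x ∈ spectrum ℝ (A i), x < τ ∧ (x ≠ 0 → dyadic τ L ≤ x) := fun i x hx =>
    hL x (Set.mem_iUnion.2 ⟨i, hx⟩) (spectrum_nonneg_of_nonneg (hA i) hx)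
  have hE := isPOVM_flagTest A hτ L
  refine (optError_le hA hE).trans ?_
  have key : ∀ i, reTrace (A i * (1 - flagTest A τ L i)) ≤
      24 * ∑ j, ∑ k, if j ≠ k then optError ![A j, A k] else 0 := fun i => by
    calc reTrace (A i * (1 - flagTest A τ L i))
        ≤ ∑ l ∈ Finset.range L, dyadic τ l *
          reTrace ((levelProj (dyadic τ (l + 1)) (A i) - levelProj (dyadic τ l) (A i)) *
            (1 - flagTest A τ L i)) := by
          have := reTrace_mul_mono_right (sub_nonneg.2 (hE.le_one i))
            (le_sum_dyadic_smul hτ (hA i) (fun x hx => (hL' i x hx).1)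
              (fun x hx => (hL' i x hx).2))
          simpa only [Finset.sum_mul, map_sum, smul_mul_assoc, map_smul, smul_eq_mul] using this
      _ ≤ ∑ l ∈ Finset.range L, dyadic τ l * (3 * ∑ j, ∑ k, if j ≠ k then
            reTrace (levelProj (dyadic τ (l + 1)) (A j) *
              levelProj (dyadic τ (l + 1)) (A k)) else 0) :=
          Finset.sum_le_sum fun l hl => mul_le_mul_of_nonneg_left
            (reTrace_layer_mul_le A hτ (Finset.mem_range.1 hl) i) (dyadic_pos hτ l).le
      _ = 3 * ∑ j, ∑ k, if j ≠ k then ∑ l ∈ Finset.range L, dyadic τ l *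
            reTrace (levelProj (dyadic τ (l + 1)) (A j) *
              levelProj (dyadic τ (l + 1)) (A k)) else 0 := by
          simp only [mul_left_comm _ (3 : ℝ), ← Finset.mul_sum]
          congr 1
          simp only [Finset.mul_sum]
          rw [Finset.sum_comm]
          refine Finset.sum_congr rfl fun j _ => ?_
          rw [Finset.sum_comm]
          refine Finset.sum_congr rfl fun k _ => ?_
          split_ifs <;> simp
      _ ≤ 3 * ∑ j, ∑ k, 8 * (if j ≠ k then optError ![A j, A k] else 0) := by
          gcongr with j _ k _
          split_ifs
          · exact sum_dyadic_overlap_le_optError hτ L (hA j) (hA k)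
          · simp
      _ = _ := by simp only [← Finset.mul_sum]; ring
  rw [errorProb_eq]
  refine (Finset.sum_le_sum fun i _ => key i).trans (le_of_eq ?_)
  rw [Finset.sum_const, Finset.card_univ, Fintype.card_fin, nsmul_eq_mul]
  ring

lemma optError_swap (A B : Matrix ι ι ℂ) : optError ![A, B] = optError ![B, A] := by
  have key : ∀ A B : Matrix ι ι ℂ, errorProb ![A, B] '' {E | IsPOVM E} ⊆
      errorProb ![B, A] '' {E | IsPOVM E} := by
    rintro A B _ ⟨E, hE, rfl⟩
    refine ⟨![E 1, E 0], ?_, ?_⟩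
    · have hE' := isPOVM_iff.1 hE
      refine isPOVM_iff.2 ⟨forall_fin_two_nonneg (hE'.1 1) (hE'.1 0), ?_⟩
      have := hE'.2
      rw [Fin.sum_univ_two] at this ⊢
      simpa [add_comm] using this
    · simp [errorProb_eq, Fin.sum_univ_two, add_comm]
  exact congrArg sInf (Set.Subset.antisymm (key A B) (key B A))

lemma optError_pair_le_reTrace {A B : Matrix ι ι ℂ} (hA : 0 ≤ A) (hB : 0 ≤ B) :
    optError ![A, B] ≤ reTrace A + reTrace B := by
  refine (optError_le (forall_fin_two_nonneg hA hB) isPOVM_zero).trans (le_of_eq ?_)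
  simp [errorProb_eq, Fin.sum_univ_two]

lemma optError_pair_le {A B E : Matrix ι ι ℂ} (hA : 0 ≤ A) (hB : 0 ≤ B) (hE : 0 ≤ E)
    (hE1 : E ≤ 1) : optError ![A, B] ≤ reTrace (A * (1 - E)) + reTrace (B * E) := by
  refine (optError_le (E := ![E, 1 - E]) (forall_fin_two_nonneg hA hB) ?_).trans (le_of_eq ?_)
  · refine isPOVM_iff.2 ⟨forall_fin_two_nonneg hE (sub_nonneg.2 hE1), ?_⟩
    simp [Fin.sum_univ_two]
  · simp [errorProb_eq, Fin.sum_univ_two]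

end Flag

/-! ### The quantum Chernoff bound -/

section Chernoff

variable {ι : Type*} [Fintype ι] [DecidableEq ι]

lemma suppPow_nonneg {A : Matrix ι ι ℂ} (hA : 0 ≤ A) (s : ℝ) : 0 ≤ suppPow A s := by
  refine cfc_nonneg fun x hx => ?_
  have := spectrum_nonneg_of_nonneg hA hx
  split_ifs
  · exact le_rfl
  · positivity

lemma suppPow_zero (A : Matrix ι ι ℂ) : suppPow A 0 = suppProj A := by
  simp [suppPow, suppProj]

lemma suppPow_one {A : Matrix ι ι ℂ} (hA : IsSelfAdjoint A) : suppPow A 1 = A := by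
  conv_rhs => rw [← cfc_id' ℝ A hA]
  rw [suppPow]
  congr 1; ext x; split_ifs <;> simp_all

lemma suppPow_mul_suppPow_one_sub {A : Matrix ι ι ℂ} (hA : 0 ≤ A) (s : ℝ) :
    suppPow A s * suppPow A (1 - s) = A := by
  rw [suppPow, suppPow,
    ← cfc_mul _ _ A (continuousOn_spectrum _ A) (continuousOn_spectrum _ A)]
  conv_rhs => rw [← cfc_id' ℝ A hA.isSelfAdjoint]
  refine cfc_congr fun x hx => ?_
  have hx0 := spectrum_nonneg_of_nonneg hA hx
  rcases hx0.eq_or_lt with rfl | hx0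
  · simp
  · simp only [hx0.ne', if_false]
    rw [← Real.rpow_add hx0, add_sub_cancel, Real.rpow_one]

open scoped Matrix.Norms.L2Operator in
/-- The Löwner-Heinz theorem for the powers `0 < s ≤ 1` of positive matrices. -/
lemma suppPow_mono {s : ℝ} (hs0 : 0 < s) (hs1 : s ≤ 1) {A B : Matrix ι ι ℂ} (hA : 0 ≤ A)
    (h : A ≤ B) : suppPow A s ≤ suppPow B s := by
  have key : ∀ C : Matrix ι ι ℂ, 0 ≤ C → suppPow C s = C ^ s := by
    intro C hC
    rw [CFC.rpow_eq_cfc_real hC, suppPow]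
    congr 1; ext x
    split_ifs with hx
    · rw [hx, Real.zero_rpow hs0.ne']
    · rfl
  rw [key A hA, key B (hA.trans h)]
  exact CFC.rpow_le_rpow ⟨hs0.le, hs1⟩ h

/-- A positive part `X` of the Hermitian matrix `D`, with the projection `E` onto its support. -/
lemma exists_posPart {D : Matrix ι ι ℂ} (hD : IsSelfAdjoint D) :
    ∃ X E : Matrix ι ι ℂ, 0 ≤ X ∧ D ≤ X ∧ 0 ≤ E ∧ E ≤ 1 ∧ D * E = X := by
  have hE := isStarProjection_cfc_indicator (fun x : ℝ => 0 ≤ x) D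
  refine ⟨cfc (fun x : ℝ => max x 0) D, _, cfc_nonneg fun x _ => le_max_right _ _, ?_, hE.nonneg,
    isStarProjection_le_one hE, ?_⟩
  · conv_lhs => rw [← cfc_id' ℝ D hD]
    exact cfc_mono (fun x _ => le_max_left _ _) (continuousOn_spectrum _ D)
      (continuousOn_spectrum _ D)
  · conv_lhs => arg 1; rw [← cfc_id' ℝ D hD]
    rw [← cfc_mul _ _ D (continuousOn_spectrum _ D) (continuousOn_spectrum _ D)]
    congr 1; ext x
    split_ifs with h
    · simp [h]
    · simp [(not_le.1 h).le]

/-- The quantum Chernoff bound: the optimal binary error is at most `Tr A ^ s B ^ (1 - s)`. In the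
interior of the interval, `C = B + (A - B)₊` dominates both `A` and `B`, and the operator
monotonicity of the powers gives `Tr A - Tr A ^ s B ^ (1 - s) ≤ Tr C - Tr B = Tr (A - B)₊`. -/
theorem optError_le_chernoffQ {A B : Matrix ι ι ℂ} (hA : 0 ≤ A) (hB : 0 ≤ B) {s : ℝ}
    (hs : s ∈ Set.Icc (0 : ℝ) 1) : optError ![A, B] ≤ chernoffQ A B s := by
  change _ ≤ reTrace (suppPow A s * suppPow B (1 - s))
  rcases hs.1.eq_or_lt with rfl | hs0
  · have hP := isStarProjection_suppProj A
    refine (optError_pair_le hA hB hP.nonneg (isStarProjection_le_one hP)).trans (le_of_eq ?_)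
    rw [suppPow_zero, sub_zero, suppPow_one hB.isSelfAdjoint, mul_sub, mul_one,
      mul_suppProj_self hA.isSelfAdjoint, sub_self, map_zero, zero_add, reTrace_mul_comm]
  rcases hs.2.eq_or_lt with rfl | hs1
  · have hP := isStarProjection_suppProj B
    refine (optError_pair_le hA hB hP.one_sub.nonneg
      (isStarProjection_le_one hP.one_sub)).trans (le_of_eq ?_)
    rw [suppPow_one hA.isSelfAdjoint, sub_self, suppPow_zero, sub_sub_cancel, mul_sub, mul_one,
      mul_suppProj_self hB.isSelfAdjoint, sub_self, map_zero, add_zero]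
  obtain ⟨X, E, hX0, hDX, hE0, hE1, hDE⟩ :=
    exists_posPart (hA.isSelfAdjoint.sub hB.isSelfAdjoint : IsSelfAdjoint (A - B))
  set C := B + X with hC
  have hBC : B ≤ C := le_add_of_nonneg_right hX0
  have hAC : A ≤ C := sub_le_iff_le_add'.1 hDX
  have hC0 : 0 ≤ C := hB.trans hBC
  have hdiff : 0 ≤ suppPow C (1 - s) - suppPow B (1 - s) :=
    sub_nonneg.2 (suppPow_mono (by linarith) (by linarith) hB hBC)
  have h1 := reTrace_mul_mono_left (suppPow_nonneg hA s)
    (suppPow_mono (s := 1 - s) (by linarith) (by linarith) hA hAC)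
  have h2 := reTrace_mul_mono_right hdiff (suppPow_mono hs0 hs1.le hA hAC)
  have h3 := reTrace_mul_mono_right (suppPow_nonneg hB (1 - s))
    (suppPow_mono hs0 hs1.le hB hBC)
  rw [suppPow_mul_suppPow_one_sub hA] at h1
  rw [suppPow_mul_suppPow_one_sub hB] at h3
  rw [mul_sub, mul_sub, map_sub, map_sub, suppPow_mul_suppPow_one_sub hC0] at h2
  have h4 := optError_pair_le hA hB hE0 hE1
  have h5 : reTrace X = reTrace (A * E) - reTrace (B * E) := by
    rw [← map_sub, ← sub_mul, hDE]
  have h6 : reTrace C = reTrace B + reTrace X := map_add _ _ _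
  rw [mul_sub, mul_one, map_sub] at h4
  linarith

lemma optError_le_chernoffQMin {A B : Matrix ι ι ℂ} (hA : 0 ≤ A) (hB : 0 ≤ B) :
    optError ![A, B] ≤ chernoffQMin A B :=
  le_csInf ((Set.nonempty_Icc.2 zero_le_one).image _)
    (by rintro _ ⟨s, hs, rfl⟩; exact optError_le_chernoffQ hA hB hs)

end Chernoff

/-! ### Error exponents -/

section Exponents

lemma elog_mono {x y : ℝ} (h : x ≤ y) : elog x ≤ elog y :=
  ENNReal.log_monotone (ENNReal.ofReal_le_ofReal h)

lemma one_div_natCast_nonneg (n : ℕ) : (0 : EReal) ≤ ((1 / (n : ℝ) : ℝ) : EReal) :=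
  EReal.coe_nonneg.2 (by positivity)

/-- The exponential rate of a sequence of nonnegative reals, as in the definition of the error
exponents, is its exponential growth rate. -/
lemma limsup_elog_eq (x : ℕ → ℝ) :
    limsup (fun n : ℕ => ((1 / (n : ℝ) : ℝ) : EReal) * elog (x n)) atTop =
      ExpGrowth.expGrowthSup fun n => ENNReal.ofReal (x n) := by
  refine congrArg (fun f => limsup f atTop) (funext fun n => ?_)
  rw [elog, EReal.div_eq_inv_mul, one_div, EReal.coe_inv]
  rfl

variable {ι : ℕ → Type*} [∀ n, Fintype (ι n)] [∀ n, DecidableEq (ι n)]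

lemma upperExponent₂_eq (A B : (n : ℕ) → Matrix (ι n) (ι n) ℂ) :
    upperExponent₂ A B =
      ExpGrowth.expGrowthSup fun n => ENNReal.ofReal (optError ![A n, B n]) := by
  rw [upperExponent₂, upperExponent, limsup_elog_eq]
  congr! 4 with n
  ext i
  fin_cases i <;> rfl

lemma upperExponent₂_comm (A B : (n : ℕ) → Matrix (ι n) (ι n) ℂ) :
    upperExponent₂ A B = upperExponent₂ B A := by
  simp only [upperExponent₂_eq, fun n => optError_swap (A n) (B n)]

/-- The error exponent of several hypotheses is determined by the worst pair. -/
theorem upperExponent_le_iSup_pairs {r : ℕ} {A : Fin r → (n : ℕ) → Matrix (ι n) (ι n) ℂ}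
    (hA : ∀ i n, 0 ≤ A i n) :
    upperExponent A ≤ ⨆ (i : Fin r) (j : Fin r) (_ : i ≠ j), upperExponent₂ (A i) (A j) := by
  have hO : ∀ i j n, 0 ≤ optError ![A i n, A j n] := fun i j n =>
    optError_nonneg (forall_fin_two_nonneg (hA i n) (hA j n))
  have h1 : upperExponent A ≤ ExpGrowth.expGrowthSup
      (∑ i, ∑ j, fun n => if i ≠ j then ENNReal.ofReal (optError ![A i n, A j n]) else 0) := by
    rw [upperExponent, limsup_elog_eq]
    refine ExpGrowth.expGrowthSup_le_of_eventually_le (b := ENNReal.ofReal (24 * r))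
      ENNReal.ofReal_ne_top (Eventually.of_forall fun n => ?_)
    refine (ENNReal.ofReal_le_ofReal (optError_le_sum_pairs fun i => hA i n)).trans
      (le_of_eq ?_)
    have hterm : ∀ i j, 0 ≤ if i ≠ j then optError ![A i n, A j n] else 0 := fun i j => by
      split_ifs
      exacts [hO i j n, le_rfl]
    rw [ENNReal.ofReal_mul (by positivity),
      ENNReal.ofReal_sum_of_nonneg fun i _ => Finset.sum_nonneg fun j _ => hterm i j]
    simp only [Finset.sum_apply]
    congr 1
    refine Finset.sum_congr rfl fun i _ => ?_
    rw [ENNReal.ofReal_sum_of_nonneg fun j _ => hterm i j]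
    refine Finset.sum_congr rfl fun j _ => ?_
    split_ifs
    · rfl
    · exact ENNReal.ofReal_zero
  refine h1.trans ?_
  simp only [ExpGrowth.expGrowthSup_sum, Finset.mem_univ, iSup_pos]
  refine iSup_mono fun i => iSup_mono fun j => ?_
  by_cases h : i = j
  · simp only [h, ne_eq, not_true_eq_false, if_false]
    exact (ExpGrowth.expGrowthSup_zero).le.trans bot_le
  · simp only [ne_eq, h, not_false_eq_true, if_true, iSup_pos]
    exact (upperExponent₂_eq _ _).ge

lemma upperExponent₂_le_neg_regChernoffDiv {A B : (n : ℕ) → Matrix (ι n) (ι n) ℂ}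
    (hA : ∀ n, 0 ≤ A n) (hB : ∀ n, 0 ≤ B n) :
    upperExponent₂ A B ≤ -regChernoffDiv A B := by
  rw [regChernoffDiv, ← EReal.limsup_neg, upperExponent₂_eq, ← limsup_elog_eq]
  refine limsup_le_limsup (Eventually.of_forall fun n => ?_)
  simp only [Pi.neg_apply, chernoffDiv, mul_neg, neg_neg]
  exact mul_le_mul_of_nonneg_left (elog_mono (optError_le_chernoffQMin (hA n) (hB n)))
    (one_div_natCast_nonneg n)

lemma upperExponent₂_nonpos {r : ℕ} {A : Fin r → (n : ℕ) → Matrix (ι n) (ι n) ℂ}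
    (hA : ∀ i n, 0 ≤ A i n)
    (htr : limsup (fun n : ℕ =>
      ((1 / (n : ℝ) : ℝ) : EReal) * elog (Matrix.trace (∑ i, A i n)).re) atTop = 0)
    {i j : Fin r} (hij : i ≠ j) : upperExponent₂ (A i) (A j) ≤ 0 := by
  rw [← htr, upperExponent₂_eq, ← limsup_elog_eq]
  refine limsup_le_limsup (Eventually.of_forall fun n => ?_)
  refine mul_le_mul_of_nonneg_left (elog_mono ?_) (one_div_natCast_nonneg n)
  refine (optError_pair_le_reTrace (hA i n) (hA j n)).trans ?_
  rw [← reTrace_apply, map_sum]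
  exact Finset.add_le_sum (f := fun i => reTrace (A i n)) (fun k _ => reTrace_nonneg (hA k n))
    (Finset.mem_univ i) (Finset.mem_univ j) hij

lemma le_half_mul_of_nonpos {x : EReal} (hx : x ≤ 0) : x ≤ ((1 / 2 : ℝ) : EReal) * x := by
  induction x with
  | bot => exact bot_le
  | top => exact absurd hx (by simp)
  | coe x =>
    rw [← EReal.coe_mul, EReal.coe_le_coe_iff]
    have : x ≤ 0 := by exact_mod_cast hx
    linarith

lemma half_mul_le_neg_half_mul {x y : EReal} (h : x ≤ -y) :
    ((1 / 2 : ℝ) : EReal) * x ≤ -(((1 / 2 : ℝ) : EReal) * y) := by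
  rw [← mul_neg]
  exact mul_le_mul_of_nonneg_left h (EReal.coe_nonneg.2 (by norm_num))

end Exponents

end StateDiscrimination

theorem mainTheorem2 {r : ℕ} {ι : ℕ → Type*} [∀ n, Fintype (ι n)] [∀ n, DecidableEq (ι n)]
    (A : Fin r → (n : ℕ) → Matrix (ι n) (ι n) ℂ)
    (hA : ∀ i n, (A i n).PosSemidef)
    (htr : limsup (fun n : ℕ =>
      ((1 / (n : ℝ) : ℝ) : EReal) * elog (Matrix.trace (∑ i, A i n)).re) atTop = 0) :
    (∀ k l : Fin r, k ≠ l →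
      upperExponent A ≤
        max (upperExponent₂ (A k) (A l))
          (⨆ (i : Fin r) (j : Fin r) (_ : i ≠ j ∧ s(i, j) ≠ s(k, l)),
            ((1 / 2 : ℝ) : EReal) * upperExponent₂ (A i) (A j)) ∧
      max (upperExponent₂ (A k) (A l))
          (⨆ (i : Fin r) (j : Fin r) (_ : i ≠ j ∧ s(i, j) ≠ s(k, l)),
            ((1 / 2 : ℝ) : EReal) * upperExponent₂ (A i) (A j)) ≤
        -min (regChernoffDiv (A k) (A l))
          (⨅ (i : Fin r) (j : Fin r) (_ : i ≠ j ∧ s(i, j) ≠ s(k, l)),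
            ((1 / 2 : ℝ) : EReal) * regChernoffDiv (A i) (A j))) ∧
    ((∃ k l : Fin r, k ≠ l ∧
        ((∀ i j : Fin r, i ≠ j → s(i, j) ≠ s(k, l) →
            ((1 / 2 : ℝ) : EReal) * upperExponent₂ (A i) (A j) ≤ upperExponent₂ (A k) (A l)) ∨
          (∀ i j : Fin r, i ≠ j → s(i, j) ≠ s(k, l) →
            regChernoffDiv (A k) (A l) ≤ ((1 / 2 : ℝ) : EReal) * regChernoffDiv (A i) (A j)))) →
      upperExponent A ≤
        (⨆ (i : Fin r) (j : Fin r) (_ : i ≠ j), upperExponent₂ (A i) (A j)) ∧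
      (⨆ (i : Fin r) (j : Fin r) (_ : i ≠ j), upperExponent₂ (A i) (A j)) ≤
        -(⨅ (i : Fin r) (j : Fin r) (_ : i ≠ j), regChernoffDiv (A i) (A j))) := by
  have hA' : ∀ i n, 0 ≤ A i n := fun i n => (hA i n).nonneg
  have hpairs := upperExponent_le_iSup_pairs hA'
  have hC : ∀ i j, upperExponent₂ (A i) (A j) ≤ -regChernoffDiv (A i) (A j) := fun i j =>
    upperExponent₂_le_neg_regChernoffDiv (hA' i) (hA' j)
  refine ⟨fun k l _ => ⟨hpairs.trans ?_, max_le ?_ ?_⟩, fun _ => ⟨hpairs, ?_⟩⟩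
  · refine iSup_le fun i => iSup_le fun j => iSup_le fun hij => ?_
    by_cases h : s(i, j) = s(k, l)
    · refine le_max_of_le_left (le_of_eq ?_)
      rcases Sym2.eq_iff.1 h with ⟨rfl, rfl⟩ | ⟨rfl, rfl⟩
      exacts [rfl, upperExponent₂_comm _ _]
    · exact le_max_of_le_right ((le_half_mul_of_nonpos (upperExponent₂_nonpos hA' htr hij)).trans
        (le_iSup_of_le i (le_iSup_of_le j (le_iSup_of_le ⟨hij, h⟩ le_rfl))))
  · exact (hC k l).trans (EReal.neg_le_neg_iff.2 (min_le_left _ _))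
  · refine iSup_le fun i => iSup_le fun j => iSup_le fun hij => ?_
    refine (half_mul_le_neg_half_mul (hC i j)).trans (EReal.neg_le_neg_iff.2 ?_)
    exact (min_le_right _ _).trans (iInf_le_of_le i (iInf_le_of_le j (iInf_le _ hij)))
  · refine iSup_le fun i => iSup_le fun j => iSup_le fun hij => ?_
    refine (hC i j).trans (EReal.neg_le_neg_iff.2 ?_)
    exact iInf_le_of_le i (iInf_le_of_le j (iInf_le _ hij))
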